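/- Let $K$ be a field of characteristic $2$, let $\Lambda=\Lambda(x_i\mid i\ge 0)$ be the Grassmann algebra over $K$ in the odd letters $x_0,x_1,x_2,\dots$, and let $\partial_i$ be the superderivative of $\Lambda$ with $\partial_i(x_j)=\delta_{ij}$. Identify $x_i$ with the left multiplication by $x_i$ on $\Lambda$, and for $i\ge 0$ let $$v_i=\partial_i+x_ix_{i+1}\bigl(\partial_{i+3}+x_{i+3}x_{i+4}\bigl(\partial_{i+6}+x_{i+6}x_{i+7}(\partial_{i+9}+\cdots)\bigr)\bigr)\in\operatorname{End}\Lambda ,$$ a sum which is finite on each element of $\Lambda$. Let $\mathbf Q=\operatorname{Lie}(v_0,v_1,v_2)\subset\operatorname{End}\Lambda$ be the Lie superalgebra generated by the odd elements $v_0,v_1,v_2$, i.e. the smallest $\mathbb Z_2$-graded subspace containing them and closed under the supercommutator and under squares $a\mapsto a^2$ of odd elements. Let $\operatorname{Lie}_p(v_0,v_1,v_2)\subset\operatorname{End}\Lambda$, $p=2$, be the restricted Lie algebra generated by the same elements, i.e. the smallest subspace containing them and closed under the commutator and under $a\mapsto a^2$. Then $\mathbf Q=\operatorname{Lie}_p(v_0,v_1,v_2)$;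 this is a restricted Lie algebra with the $p$-mapping $a\mapsto a^{[2]}=a^2$; and this $p$-mapping is nil: for every $a\in\mathbf Q$ there is $n\ge 0$ with $a^{[2^n]}=0$, i.e. $a^{2^n}=0$ in $\operatorname{End}\Lambda$. -/

import Mathlib

open scoped TensorProduct

/-! An associative algebra is a Lie algebra under the commutator `⁅a, b⁆ = a * b - b * a`. -/
attribute [local instance] LieRing.ofAssociativeRing

noncomputable section

namespace FractalLie

/-! ### The Grassmann algebra in infinitely many variables and its superderivatives -/

/-- The Grassmann algebra `Λ = Λ(x_i | i ≥ 0)` over `K`. -/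
abbrev Grassmann (K : Type*) [Field K] : Type _ := ExteriorAlgebra K (ℕ →₀ K)

/-- The Grassmann letter `x_i`. -/
def gx (K : Type*) [Field K] (i : ℕ) : Grassmann K :=
  ExteriorAlgebra.ι K (Finsupp.single i (1 : K))

/-- The superderivative `∂_i` of `Λ` with `∂_i (x_j) = δ_{ij}`: the contraction with the `i`-th
coordinate functional, so that `∂_i (m * b) = m_i • b - m * ∂_i b` for `m = ∑ m_j x_j`. -/
def gd (K : Type*) [Field K] (i : ℕ) : Module.End K (Grassmann K) :=
  CliffordAlgebra.contractLeft (Q := (0 : QuadraticForm K (ℕ →₀ K)))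
    (Finsupp.lapply i : (ℕ →₀ K) →ₗ[K] K)

/-- The parity decomposition of `Λ`: `α = 0` is the even part, `α = 1` the odd part. -/
def gParity (K : Type*) [Field K] (α : ZMod 2) : Submodule K (Grassmann K) :=
  CliffordAlgebra.evenOdd (0 : QuadraticForm K (ℕ →₀ K)) α

/-- The parity decomposition of `End Λ`: the maps sending `Λ_β` to `Λ_{α+β}` for all `β`. -/
def endParity (K : Type*) [Field K] (α : ZMod 2) :
    Submodule K (Module.End K (Grassmann K)) where
  carrier := {φ | ∀ β : ZMod 2, ∀ f ∈ gParity K β, φ f ∈ gParity K (α + β)}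
  add_mem' ha hb β f hf := Submodule.add_mem _ (ha β f hf) (hb β f hf)
  zero_mem' _ _ _ := Submodule.zero_mem _
  smul_mem' c _ ha β f hf := Submodule.smul_mem _ c (ha β f hf)

/-- Each element of `Λ` involves finitely many letters, hence is killed by almost all `∂_i`. -/
theorem finite_gd_ne_zero (K : Type*) [Field K] (f : Grassmann K) :
    {i : ℕ | gd K i f ≠ 0}.Finite := by
  induction f using CliffordAlgebra.left_induction with
  | algebraMap r =>
    refine Set.Finite.subset Set.finite_empty fun i hi => hi ?_
    exact CliffordAlgebra.contractLeft_algebraMap _ _ r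
  | add a b ha hb =>
    refine (ha.union hb).subset fun i hi => ?_
    by_contra h
    simp only [Set.mem_union, Set.mem_ofPred_eq, not_or, not_not] at h
    exact hi (by rw [map_add, h.1, h.2, add_zero])
  | ι_mul a m ha =>
    refine (ha.union m.support.finite_toSet).subset fun i hi => ?_
    by_contra h
    simp only [Set.mem_union, Set.mem_ofPred_eq, not_or, not_not, Finset.mem_coe,
      Finsupp.mem_support_iff] at h
    refine hi ((CliffordAlgebra.contractLeft_ι_mul _ _ _).trans ?_)
    have h1 : (CliffordAlgebra.contractLeft (Q := (0 : QuadraticForm K (ℕ →₀ K)))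
      (Finsupp.lapply i : (ℕ →₀ K) →ₗ[K] K)) a = 0 := h.1
    rw [h1, Finsupp.lapply_apply, h.2, zero_smul, mul_zero, sub_zero]

/-! ### The pivot elements -/

/-- The coefficient `x_i x_{i+1} x_{i+3} x_{i+4} ⋯ x_{i+3l-3} x_{i+3l-2}` of `∂_{i+3l}` in `v_i`. -/
def pivotCoeff (K : Type*) [Field K] (i : ℕ) : ℕ → Grassmann K
  | 0 => 1
  | l + 1 => pivotCoeff K i l * (gx K (i + 3 * l) * gx K (i + 3 * l + 1))

theorem finite_pivot_support (K : Type*) [Field K] (i : ℕ) (f : Grassmann K) :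
    (Function.support fun l : ℕ => pivotCoeff K i l * gd K (i + 3 * l) f).Finite := by
  refine Set.Finite.subset (Set.Finite.preimage (f := fun l : ℕ => i + 3 * l)
    (fun a _ b _ h => by simpa using h) (finite_gd_ne_zero K f)) fun l hl h => hl ?_
  simp only [h, mul_zero]

/-- The pivot element
`v_i = ∂_i + x_i x_{i+1} (∂_{i+3} + x_{i+3} x_{i+4} (∂_{i+6} + ⋯))`, acting on `Λ`;
on every element of `Λ` only finitely many summands are nonzero. -/
def pivot (K : Type*) [Field K] (i : ℕ) : Module.End K (Grassmann K) where
  toFun f := ∑ᶠ l : ℕ, pivotCoeff K i l * gd K (i + 3 * l) f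
  map_add' f g := by
    simp only [map_add, mul_add]
    exact finsum_add_distrib (finite_pivot_support K i f) (finite_pivot_support K i g)
  map_smul' c f := by
    simp only [map_smul, mul_smul_comm, RingHom.id_apply]
    exact (smul_finsum' c (finite_pivot_support K i f)).symm

/-- The generators `v_0, v_1, v_2`. -/
def generators (K : Type*) [Field K] : Set (Module.End K (Grassmann K)) :=
  {pivot K 0, pivot K 1, pivot K 2}

/-! ### The Lie superalgebra generated by a set of endomorphisms -/

/-- `S` is a subalgebra of the Lie superalgebra `(End Λ)^{(-)}`: a `ℤ/2`-graded subspace, closed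
under the supercommutator `[a, b] = a b - (-1)^{|a||b|} b a` of homogeneous elements and under
squares of odd elements (automatic unless the characteristic is `2`, as `[a, a] = 2 a²`). -/
structure IsLieSuperSubalgebra (K : Type*) [Field K]
    (S : Submodule K (Module.End K (Grassmann K))) : Prop where
  graded : ∀ a ∈ S, ∃ a₀ ∈ S ⊓ endParity K 0, ∃ a₁ ∈ S ⊓ endParity K 1, a = a₀ + a₁
  bracket_mem : ∀ α β : ZMod 2, ∀ a ∈ S ⊓ endParity K α, ∀ b ∈ S ⊓ endParity K β,
    a * b - (-1 : K) ^ (α.val * β.val) • (b * a) ∈ S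
  sq_mem : ∀ a ∈ S ⊓ endParity K 1, a ^ 2 ∈ S

/-- `Lie(X)`: the Lie superalgebra generated by `X ⊆ End Λ`. -/
def lieSuperClosure (K : Type*) [Field K] (X : Set (Module.End K (Grassmann K))) :
    Submodule K (Module.End K (Grassmann K)) :=
  sInf {S | X ⊆ (S : Set (Module.End K (Grassmann K))) ∧ IsLieSuperSubalgebra K S}

/-- The Lie superalgebra `Q = Lie(v_0, v_1, v_2)`. -/
def Q (K : Type*) [Field K] : Submodule K (Module.End K (Grassmann K)) :=
  lieSuperClosure K (generators K)

/-! ### Restricted Lie algebras -/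

/-- The linear map `L[t] → L`, `K[t] ⊗ L → L`, extracting the coefficient of `t^n`. -/
def lieCoeff (K L : Type*) [Field K] [LieRing L] [LieAlgebra K L] (n : ℕ) :
    Polynomial K ⊗[K] L →ₗ[K] L :=
  (TensorProduct.lid K L).toLinearMap ∘ₗ (Polynomial.lcoeff K n).rTensor L

/-- The element `s_i(x, y)`, `i ≥ 1`, of a Lie algebra over a field of characteristic `p`:
`i s_i(x, y)` is the coefficient of `t^{i-1}` in `ad(t x + y)^{p-1}(x) ∈ L[t]`
(to be used only for `1 ≤ i < p`, where `i` is invertible in `K`). -/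
def jacobsonS (K L : Type*) [Field K] [LieRing L] [LieAlgebra K L] (p i : ℕ) (x y : L) : L :=
  (i : K)⁻¹ • lieCoeff K L (i - 1)
    ((fun z : Polynomial K ⊗[K] L =>
      ⁅(Polynomial.X : Polynomial K) ⊗ₜ[K] x + (1 : Polynomial K) ⊗ₜ[K] y, z⁆)^[p - 1]
      ((1 : Polynomial K) ⊗ₜ[K] x))

/-- `φ` is a `p`-mapping on the Lie algebra `L` over `K`, i.e. `(L, φ)` is a restricted Lie
algebra. -/
structure IsPMapping (K L : Type*) [Field K] [LieRing L] [LieAlgebra K L] (p : ℕ) (φ : L → L) :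
    Prop where
  map_smul : ∀ (c : K) (x : L), φ (c • x) = c ^ p • φ x
  ad_map : ∀ x : L, LieAlgebra.ad K L (φ x) = LieAlgebra.ad K L x ^ p
  map_add : ∀ x y : L,
    φ (x + y) = φ x + φ y + ∑ i ∈ Finset.Ico 1 p, jacobsonS K L p i x y

/-- The `p`-mapping `φ` is nil: every `x` satisfies `x^{[p^n]} = 0` for some `n`. -/
def IsNilPMapping {L : Type*} [Zero L] (φ : L → L) : Prop :=
  ∀ x : L, ∃ n : ℕ, φ^[n] x = 0

/-- `Lie_p(X)`: the restricted Lie algebra generated by a subset `X` of an associative algebra `A`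
(with the commutator and the `p`-mapping `a ↦ a^p`). -/
def restrictedLieClosure (K : Type*) {A : Type*} [Field K] [Ring A] [Algebra K A] (p : ℕ)
    (X : Set A) : LieSubalgebra K A :=
  sInf {S | X ⊆ (S : Set A) ∧ ∀ a ∈ S, a ^ p ∈ S}

theorem pow_mem_restrictedLieClosure (K : Type*) {A : Type*} [Field K] [Ring A] [Algebra K A]
    (p : ℕ) (X : Set A) {a : A} (ha : a ∈ restrictedLieClosure K p X) :
    a ^ p ∈ restrictedLieClosure K p X := by
  rw [restrictedLieClosure, ← SetLike.mem_coe, LieSubalgebra.coe_sInf, Set.mem_iInter₂] at ha ⊢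
  exact fun S hS => hS.2 a (ha S hS)

/-- The `p`-mapping `a ↦ a^p` of `Lie_p(X)`. -/
def restrictedLieClosurePMap (K : Type*) {A : Type*} [Field K] [Ring A] [Algebra K A] (p : ℕ)
    (X : Set A) (a : restrictedLieClosure K p X) : restrictedLieClosure K p X :=
  ⟨(a : A) ^ p, pow_mem_restrictedLieClosure K p X a.2⟩

end FractalLie

end

/-! Everything rests on monomials `x^S v_n` in which all letters lie well below `n` (`Admissible`).
From `v_n = d_n + x_n x_{n+1} v_{n+3}` one gets `v_n² = x_{n+1} v_{n+3}` and `[v_n, v_{n+1}] = x_n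
v_{n+3}`; in general the bracket of two admissible monomials is zero or one admissible monomial,
never a proper sum (`isZeroOrMonomial_anticomm`).

Equality of the closures: the admissible monomials lying in a subspace that is closed under their
brackets and under squares of pivots span a restricted Lie algebra (`restrictedLieClosure_le_span`).
With the subspace `Lie_p`, this shows that `Lie_p` is spanned by parity-homogeneous elements, so it
is graded and contains `Q`; with the subspace `Q`, it gives the reverse inclusion. Signs disappear
in characteristic 2.

Nilpotency: give `v_n` weight `λ^n` and `x_n` weight `-λ^n`. The root `λ ≈ 1.52` of `λ³ = λ + 2`
would make the pivots homogeneous; the rational value `λ = 3/2` below it makes brackets and squares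
at worst lose weight, keeps `λ² > 2`, and still bounds below by `λ^k` the weight of an admissible
monomial with indices `≥ k`. Write `a = t d_k + b + x_k c` with `b`, `c` free of index `k`. If `t =
0`, only `b` matters. Otherwise `a² = (t c + b²) + x_k [b, c]`, and removing `x_k` and then
`x_{k+1}` leaves an element of level `k + 2` and weight at most `2W`. As `2/λ² = 8/9`, the
normalized weight `W/λ^k` contracts until it is below 1, where the span is zero
(`isNilpotent_of_mem_monSpan_of_lt`). -/

namespace FractalLie

/-! ### Pivot systems in an associative algebra of characteristic two -/

/-- The relations between the letters `x i`, the superderivatives `d i` and the pivot elements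
`v i` that determine the bracket and the square of monomials, in characteristic `2`. -/
structure IsPivotSystem {A : Type*} [Ring A] (x d v : ℕ → A) : Prop where
  x_comm : ∀ i j, Commute (x i) (x j)
  x_sq : ∀ i, x i * x i = 0
  d_sq : ∀ i, d i * d i = 0
  d_x : ∀ i, d i * x i + x i * d i = 1
  d_x_comm : ∀ i j, i ≠ j → Commute (d i) (x j)
  v_eq : ∀ i, v i = d i + x i * (x (i + 1) * v (i + 3))
  x_v : ∀ i j, j < i → Commute (x j) (v i)
  d_v : ∀ i j, j < i → Commute (d j) (v i)

/-- The product of the letters `x i`, `i ∈ S`. -/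
def xprod {A : Type*} [Ring A] (x : ℕ → A) (S : Finset ℕ) : A :=
  ((S.sort (· ≤ ·)).map x).prod

/-- The weight `(3/2)^n` of the pivot element `v n`; the weight of `x n` is `-(3/2)^n`. -/
def pivotWeight (n : ℕ) : ℚ := (3 / 2 : ℚ) ^ n

theorem pivotWeight_pos (n : ℕ) : 0 < pivotWeight n := by
  unfold pivotWeight; positivity

theorem pivotWeight_succ (n : ℕ) : pivotWeight (n + 1) = 3 / 2 * pivotWeight n := by
  unfold pivotWeight; ring

theorem pivotWeight_add_two (n : ℕ) : pivotWeight (n + 2) = 9 / 4 * pivotWeight n := by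
  unfold pivotWeight; ring

theorem pivotWeight_add_three (n : ℕ) : pivotWeight (n + 3) = 27 / 8 * pivotWeight n := by
  unfold pivotWeight; ring

theorem pivotWeight_add_five (n : ℕ) : pivotWeight (n + 5) = 243 / 32 * pivotWeight n := by
  unfold pivotWeight; ring

/-- The weight of the monomial `x^S v_n`. -/
def monWeight (S : Finset ℕ) (n : ℕ) : ℚ := pivotWeight n - ∑ i ∈ S, pivotWeight i

/-- The monomials `x^S v_n` with `S ⊆ [k, n - 3]`, or with `S = {n - 2}`, `k ≤ n - 2`. -/
def Admissible (k : ℕ) (S : Finset ℕ) (n : ℕ) : Prop :=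
  (∀ i ∈ S, k ≤ i) ∧ ((∀ i ∈ S, i + 3 ≤ n) ∨ ∃ j, j + 2 = n ∧ S = {j})

theorem Admissible.add_two_le {k n : ℕ} {S : Finset ℕ} (h : Admissible k S n) {i : ℕ}
    (hi : i ∈ S) : i + 2 ≤ n := by
  obtain ⟨-, h | ⟨j, rfl, rfl⟩⟩ := h
  · have := h i hi; omega
  · simp at hi; omega

theorem Admissible.empty (k n : ℕ) : Admissible k ∅ n := by
  simp [Admissible]

/-- Admissible monomials supported on indices `≥ k` have weight at least that of `v k`. -/
theorem pivotWeight_le_monWeight {k n : ℕ} {S : Finset ℕ} (hk : k ≤ n) (h : Admissible k S n) :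
    pivotWeight k ≤ monWeight S n := by
  -- Geometric sum of ratio 3/2; the factor 2 is `1 / (3/2 - 1)`.
  have sum_Ico : ∀ m : ℕ, ∑ i ∈ Finset.Ico k (k + m), pivotWeight i
      = 2 * pivotWeight (k + m) - 2 * pivotWeight k := by
    intro m
    induction m with
    | zero => simp
    | succ m ih =>
      rw [← add_assoc, Finset.sum_Ico_succ_top (by omega), ih, pivotWeight_succ]; ring
  have hmono : pivotWeight k ≤ pivotWeight n := by
    unfold pivotWeight; exact pow_le_pow_right₀ (by norm_num) hk
  have hkp := pivotWeight_pos k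
  obtain ⟨h1, h | ⟨j, rfl, rfl⟩⟩ := h
  · unfold monWeight
    rcases lt_or_ge n (k + 3) with hn | hn
    · have : S = ∅ := by
        ext i; simp only [Finset.notMem_empty, iff_false]
        intro hi; have := h i hi; have := h1 i hi; omega
      simpa [this] using hmono
    · obtain ⟨m, rfl⟩ := Nat.exists_eq_add_of_le hn
      have hS : S ⊆ Finset.Ico k (k + (m + 1)) := by
        intro i hi
        have := h i hi; have := h1 i hi
        simp; omega
      have hle := Finset.sum_le_sum_of_subset_of_nonneg hS
        (f := pivotWeight) fun i _ _ => (pivotWeight_pos i).le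
      rw [sum_Ico] at hle
      -- The pivot weighs 9/4 of the weight at `n - 2`, while all letters together take away less
      -- than 2 of it.
      have e : k + 3 + m = k + (m + 1) + 2 := by omega
      have := pivotWeight_pos (k + (m + 1))
      rw [e, pivotWeight_add_two]
      linarith
  · have hj : k ≤ j := h1 j (by simp)
    have : pivotWeight k ≤ pivotWeight j := by
      unfold pivotWeight; exact pow_le_pow_right₀ (by norm_num) hj
    simp only [monWeight, Finset.sum_singleton, pivotWeight_add_two]
    linarith

/-- `a` is zero or a monomial `x^U v_p` with `p ≥ q`, `U ⊆ [k, p - 3]`, of weight at most `W`. -/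
def IsZeroOrMonomial {A : Type*} [Ring A] (x v : ℕ → A) (k q : ℕ) (W : ℚ) (a : A) : Prop :=
  a = 0 ∨ ∃ (U : Finset ℕ) (p : ℕ), q ≤ p ∧ (∀ i ∈ U, k ≤ i ∧ i + 3 ≤ p) ∧ monWeight U p ≤ W ∧
    a = xprod x U * v p

theorem IsZeroOrMonomial.mono {A : Type*} [Ring A] {x v : ℕ → A} {k q q' : ℕ} {W W' : ℚ} {a : A}
    (h : IsZeroOrMonomial x v k q W a) (hq : q' ≤ q) (hW : W ≤ W') :
    IsZeroOrMonomial x v k q' W' a := by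
  obtain rfl | ⟨U, p, h1, h2, h3, rfl⟩ := h
  · exact .inl rfl
  · exact .inr ⟨U, p, hq.trans h1, h2, h3.trans hW, rfl⟩

namespace IsPivotSystem

variable {A : Type*} [Ring A] {x d v : ℕ → A}

/-! ### Products of commuting, square-zero letters -/

theorem pairwise_commute (H : IsPivotSystem x d v) (S : Finset ℕ) :
    (S : Set ℕ).Pairwise (Function.onFun Commute x) :=
  fun i _ j _ _ => H.x_comm i j

theorem xprod_eq (H : IsPivotSystem x d v) (S : Finset ℕ) :
    xprod x S = S.noncommProd x (H.pairwise_commute S) := by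
  have := Finset.noncommProd_toFinset (S.sort (· ≤ ·)) x (H.pairwise_commute _)
    (Finset.sort_nodup _ _)
  rw [xprod, ← this]
  simp

theorem xprod_empty (x : ℕ → A) : xprod x ∅ = 1 := by
  simp [xprod]

theorem xprod_singleton (x : ℕ → A) (i : ℕ) : xprod x {i} = x i := by
  simp [xprod]

theorem xprod_insert (H : IsPivotSystem x d v) {S : Finset ℕ} {i : ℕ} (hi : i ∉ S) :
    xprod x (insert i S) = x i * xprod x S := by
  rw [H.xprod_eq, H.xprod_eq, Finset.noncommProd_insert_of_notMem _ _ _ _ hi]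

theorem x_mul_xprod_of_mem (H : IsPivotSystem x d v) {S : Finset ℕ} {i : ℕ} (hi : i ∈ S) :
    x i * xprod x S = 0 := by
  rw [← Finset.insert_erase hi, H.xprod_insert (Finset.notMem_erase i S), ← mul_assoc, H.x_sq,
    zero_mul]

theorem commute_xprod (H : IsPivotSystem x d v) {S : Finset ℕ} {a : A}
    (h : ∀ i ∈ S, Commute a (x i)) : Commute a (xprod x S) := by
  rw [H.xprod_eq]
  exact Finset.noncommProd_commute _ _ _ _ h

theorem x_commute_xprod (H : IsPivotSystem x d v) (i : ℕ) (S : Finset ℕ) :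
    Commute (x i) (xprod x S) :=
  H.commute_xprod fun j _ => H.x_comm i j

theorem xprod_mul_self (H : IsPivotSystem x d v) {S : Finset ℕ} (hS : S.Nonempty) :
    xprod x S * xprod x S = 0 := by
  obtain ⟨i, hi⟩ := hS
  conv_lhs => enter [1]; rw [← Finset.insert_erase hi, H.xprod_insert (Finset.notMem_erase i S)]
  rw [(H.x_commute_xprod i _).eq, mul_assoc, H.x_mul_xprod_of_mem hi, mul_zero]

theorem v_commute_xprod (H : IsPivotSystem x d v) {S : Finset ℕ} {n : ℕ} (h : ∀ i ∈ S, i < n) :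
    Commute (v n) (xprod x S) :=
  H.commute_xprod fun i hi => (H.x_v n i (h i hi)).symm

theorem isZeroOrMonomial_x_mul (H : IsPivotSystem x d v) {k q i : ℕ} {W : ℚ} {a : A}
    (h : IsZeroOrMonomial x v k q W a) (hk : k ≤ i) (hq : i + 3 ≤ q) :
    IsZeroOrMonomial x v k q (W - pivotWeight i) (x i * a) := by
  obtain rfl | ⟨U, p, h1, h2, h3, rfl⟩ := h
  · exact .inl (mul_zero _)
  by_cases hi : i ∈ U
  · left
    rw [← mul_assoc, H.x_mul_xprod_of_mem hi, zero_mul]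
  · refine .inr ⟨insert i U, p, h1, ?_, ?_, ?_⟩
    · intro j hj
      obtain rfl | hj := Finset.mem_insert.1 hj
      · exact ⟨hk, hq.trans h1⟩
      · exact h2 j hj
    · unfold monWeight at h3 ⊢
      rw [Finset.sum_insert hi]; linarith
    · rw [H.xprod_insert hi, mul_assoc]

theorem isZeroOrMonomial_xprod_mul (H : IsPivotSystem x d v) {k q : ℕ} {W : ℚ} {a : A}
    (h : IsZeroOrMonomial x v k q W a) (S : Finset ℕ) (hS : ∀ i ∈ S, k ≤ i ∧ i + 3 ≤ q) :
    IsZeroOrMonomial x v k q (W - ∑ i ∈ S, pivotWeight i) (xprod x S * a) := by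
  induction S using Finset.induction_on with
  | empty => simpa [xprod_empty] using h
  | insert i S hi ih =>
    have h1 := hS i (by simp)
    rw [H.xprod_insert hi, mul_assoc, Finset.sum_insert hi]
    have := H.isZeroOrMonomial_x_mul (ih fun j hj => hS j (by simp [hj])) h1.1 h1.2
    exact this.mono le_rfl (by linarith)

/-! ### Brackets of monomials -/

/-- If `x` divides the second factor, then `d + x z` acts on it as `d`. -/
theorem anticomm_of_dvd {d x y z : A} (hdx : d * x + x * d = 1) (hx : x * x = 0)
    (hxz : Commute x z) (hxy : Commute x y) (hdy : Commute d y) :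
    (d + x * z) * (x * y) + (x * y) * (d + x * z) = y := by
  have e1 : x * z * (x * y) = 0 := by
    rw [hxz.eq, mul_assoc, ← mul_assoc x, hx, zero_mul, mul_zero]
  have e2 : x * y * (x * z) = 0 := by
    rw [hxy.eq, mul_assoc, ← mul_assoc x, hx, zero_mul, mul_zero]
  rw [add_mul, mul_add, e1, e2, add_zero, add_zero, mul_assoc, ← hdy.eq, ← mul_assoc, ← mul_assoc,
    ← add_mul, hdx, one_mul]

theorem v_anticomm_x (H : IsPivotSystem x d v) (n : ℕ) : v n * x n + x n * v n = 1 := by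
  have := anticomm_of_dvd (H.d_x n) (H.x_sq n)
    ((H.x_comm n (n + 1)).mul_right (H.x_v (n + 3) n (by omega))) (Commute.one_right _)
    (Commute.one_right (d n))
  rwa [mul_one, ← H.v_eq] at this

/-- In `v_n = d_n + x_n c` both summands square to zero and `c` commutes with `x_n` and `d_n`, so
the cross terms give `(d_n x_n + x_n d_n) c = c`. -/
theorem v_mul_self (H : IsPivotSystem x d v) (n : ℕ) : v n * v n = x (n + 1) * v (n + 3) := by
  have hc : Commute (x n) (x (n + 1) * v (n + 3)) :=
    (H.x_comm _ _).mul_right (H.x_v _ _ (by omega))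
  have hd : Commute (d n) (x (n + 1) * v (n + 3)) :=
    (H.d_x_comm _ _ (by omega)).mul_right (H.d_v _ _ (by omega))
  have e := anticomm_of_dvd (H.d_x n) (H.x_sq n) hc hc hd
  rw [← H.v_eq] at e
  set c := x (n + 1) * v (n + 3)
  have z : x n * c * (x n * c) = 0 := by
    rw [mul_assoc (x n), ← mul_assoc c, ← hc.eq]
    simp only [← mul_assoc, H.x_sq, zero_mul]
  have : v n = d n + x n * c := H.v_eq n
  calc v n * v n = (d n * d n + x n * c * (x n * c)) + (d n * (x n * c) + x n * c * d n) := by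
        rw [this]; noncomm_ring
    _ = d n * (x n * c) + x n * c * d n := by rw [H.d_sq, z]; simp
    _ = (v n * (x n * c) + x n * c * v n) - (x n * c * (x n * c) + x n * c * (x n * c)) := by
        rw [this]; noncomm_ring
    _ = c := by rw [z, e]; simp

section Bracket

variable [CharP A 2]

theorem anticomm_of_commute {d x y z : A} (hxy : Commute x y) (hdy : Commute d y) :
    (d + x * z) * y + y * (d + x * z) = x * (z * y + y * z) := by
  rw [add_mul, mul_add, hdy.eq, ← mul_assoc y, ← hxy.eq, mul_add, mul_assoc, mul_assoc]
  have := CharTwo.add_self_eq_zero (y * d)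
  calc _ = (y * d + y * d) + (x * (z * y) + x * (y * z)) := by abel
    _ = _ := by rw [this, zero_add]

/-- The bracket of `v_n` with an element that commutes with `x_n`, `x_{n+1}` and `∂_n`. -/
theorem v_anticomm (H : IsPivotSystem x d v) {n : ℕ} {y : A} (hx : Commute (x n) y)
    (hx' : Commute (x (n + 1)) y) (hd : Commute (d n) y) :
    v n * y + y * v n = x n * (x (n + 1) * (v (n + 3) * y + y * v (n + 3))) := by
  rw [H.v_eq n, anticomm_of_commute hx hd]
  congr 1
  rw [mul_add, mul_assoc, ← mul_assoc y, ← hx'.eq, mul_assoc]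

/-- Needed only for divisibility: the bracket is killed by `x_n`. -/
theorem v_anticomm_v_add_two (H : IsPivotSystem x d v) (n : ℕ) :
    v n * v (n + 2) + v (n + 2) * v n
      = x n * (x (n + 1) * (v (n + 3) * v (n + 2) + v (n + 2) * v (n + 3))) :=
  H.v_anticomm (H.x_v _ _ (by omega)) (H.x_v _ _ (by omega)) (H.d_v _ _ (by omega))

/-- `[v_n, x^T v_{n+1}] = x_n x^T v_{n+3}` for `T ⊆ [0, n-1]`. -/
theorem v_anticomm_xprod_v_succ (H : IsPivotSystem x d v) {n : ℕ} {T : Finset ℕ}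
    (hT : ∀ i ∈ T, i < n) :
    v n * (xprod x T * v (n + 1)) + xprod x T * v (n + 1) * v n
      = x n * (xprod x T * v (n + 3)) := by
  have hd : Commute (d n) (xprod x T) :=
    H.commute_xprod fun i hi => H.d_x_comm n i (hT i hi).ne'
  rw [H.v_eq n, anticomm_of_commute
    ((H.x_commute_xprod n T).mul_right (H.x_v _ _ (by omega)))
    (hd.mul_right (H.d_v _ _ (by omega)))]
  congr 1
  have h3 : Commute (v (n + 3)) (xprod x T) :=
    H.v_commute_xprod fun i hi => by have := hT i hi; omega
  have hx := H.x_commute_xprod (n + 1) T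
  have e := H.v_anticomm_v_add_two (n + 1)
  have e1 := H.v_anticomm_x (n + 1)
  set P := xprod x T
  -- The bracket of `v_{n+1}` and `v_{n+3}` is divisible by `x_{n+1}`.
  have z : x (n + 1) * (v (n + 3) * v (n + 1) + v (n + 1) * v (n + 3)) = 0 := by
    rw [add_comm (v (n + 3) * _), e, ← mul_assoc, H.x_sq, zero_mul]
  have e2 : v (n + 1) * x (n + 1) = 1 + x (n + 1) * v (n + 1) := by
    rw [← e1, add_assoc, CharTwo.add_self_eq_zero, add_zero]
  calc x (n + 1) * v (n + 3) * (P * v (n + 1)) + P * v (n + 1) * (x (n + 1) * v (n + 3))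
      = x (n + 1) * (v (n + 3) * P) * v (n + 1) + P * (v (n + 1) * x (n + 1)) * v (n + 3) := by
        simp only [mul_assoc]
    _ = (x (n + 1) * P) * (v (n + 3) * v (n + 1)) + P * (1 + x (n + 1) * v (n + 1)) * v (n + 3) := by
        rw [h3.eq, e2]; simp only [mul_assoc]
    _ = P * v (n + 3) + P * (x (n + 1) * (v (n + 3) * v (n + 1) + v (n + 1) * v (n + 3))) := by
        rw [hx.eq]; noncomm_ring
    _ = _ := by rw [z, mul_zero, add_zero]

theorem v_anticomm_v_succ (H : IsPivotSystem x d v) (n : ℕ) :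
    v n * v (n + 1) + v (n + 1) * v n = x n * v (n + 3) := by
  simpa [xprod_empty] using H.v_anticomm_xprod_v_succ (n := n) (T := ∅) (by simp)

/-- The bracket of `v_n` with an admissible monomial `x^T v_m`, `n ≤ m`, is a monomial or zero. -/
theorem isZeroOrMonomial_v_anticomm (H : IsPivotSystem x d v) {k n m : ℕ} {T : Finset ℕ}
    (hk : k ≤ n) (hnm : n ≤ m) (hT : Admissible k T m) :
    IsZeroOrMonomial x v k (n + 2) (pivotWeight n + monWeight T m)
      (v n * (xprod x T * v m) + xprod x T * v m * v n) := by
  -- The recursion for `v_n` replaces `n` by `n + 3` while `T` and `m` stay fixed.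
  induction hr : m - n using Nat.strong_induction_on generalizing n with
  | _ r ih =>
  -- If `n ∈ T`, then `v_n` acts as `d_n` and deletes the letter `x_n`.
  by_cases hn : n ∈ T
  · have hm := hT.add_two_le hn
    have e : xprod x T * v m = x n * (xprod x (T.erase n) * v m) := by
      rw [← mul_assoc, ← H.xprod_insert (Finset.notMem_erase n T), Finset.insert_erase hn]
    have hc : Commute (d n) (xprod x (T.erase n) * v m) :=
      (H.commute_xprod fun i hi => H.d_x_comm n i (Finset.ne_of_mem_erase hi).symm).mul_right
        (H.d_v _ _ (by omega))
    refine .inr ⟨T.erase n, m, hm, ?_, ?_, ?_⟩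
    · intro i hi
      obtain ⟨h1, h2 | ⟨j, rfl, rfl⟩⟩ := hT
      · exact ⟨h1 i (Finset.mem_of_mem_erase hi), h2 i (Finset.mem_of_mem_erase hi)⟩
      · simp at hi hn; omega
    · have := Finset.add_sum_erase T pivotWeight hn
      unfold monWeight
      linarith
    · rw [e, H.v_eq n]
      exact anticomm_of_dvd (H.d_x n) (H.x_sq n)
        ((H.x_comm _ _).mul_right (H.x_v _ _ (by omega)))
        ((H.x_commute_xprod _ _).mul_right (H.x_v _ _ (by omega))) hc
  have hlt : ∀ i ∈ T, i + 2 ≤ m := fun i hi => hT.add_two_le hi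
  -- For `n = m` the bracket is twice `x^T v_n²`, hence zero.
  rcases eq_or_lt_of_le hnm with rfl | hnm
  · left
    rw [mul_assoc, ← mul_assoc, (H.v_commute_xprod fun i hi => by have := hlt i hi; omega).eq,
      mul_assoc, CharTwo.add_self_eq_zero]
  have hT1 := hT.1
  rcases eq_or_lt_of_le (Nat.succ_le_of_lt hnm) with rfl | hnm1
  · have hT' : ∀ i ∈ T, i < n := fun i hi => by have := hlt i hi; omega
    rw [H.v_anticomm_xprod_v_succ hT', ← mul_assoc, ← H.xprod_insert hn]
    refine .inr ⟨insert n T, n + 3, by omega, ?_, ?_, rfl⟩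
    · intro i hi
      obtain rfl | hi := Finset.mem_insert.1 hi
      · exact ⟨hk, le_rfl⟩
      · exact ⟨hT1 i hi, by have := hT' i hi; omega⟩
    · unfold monWeight
      rw [Finset.sum_insert hn, pivotWeight_add_three, Nat.succ_eq_add_one, pivotWeight_succ]
      have := pivotWeight_pos n
      linarith
  have hv : v n * (xprod x T * v m) + xprod x T * v m * v n
      = x n * (x (n + 1) * (v (n + 3) * (xprod x T * v m) + xprod x T * v m * v (n + 3))) :=
    H.v_anticomm ((H.x_commute_xprod _ _).mul_right (H.x_v _ _ (by omega)))
      ((H.x_commute_xprod _ _).mul_right (H.x_v _ _ (by omega)))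
      ((H.commute_xprod fun i hi => H.d_x_comm n i fun h => hn (h ▸ hi)).mul_right
        (H.d_v _ _ (by omega)))
  -- The weight budget is the target plus the weights `pivotWeight n` and `pivotWeight (n + 1)` that
  -- `x_n` and `x_{n+1}` will take away.
  have key : IsZeroOrMonomial x v k (n + 5)
      (2 * pivotWeight n + pivotWeight (n + 1) + monWeight T m)
      (v (n + 3) * (xprod x T * v m) + xprod x T * v m * v (n + 3)) := by
    -- For `m = n + 2` the index `n + 3` overtakes `m`, so the induction does not apply and the
    -- bracket of consecutive pivots is used instead.
    rcases eq_or_lt_of_le (Nat.succ_le_of_lt hnm1) with rfl | hnm2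
    · have hT' : ∀ i ∈ T, i ≤ n := fun i hi => by have := hlt i hi; omega
      have h2 : (n + 2) ∉ T := fun h => by have := hT' _ h; omega
      have hc : Commute (v (n + 3)) (xprod x T) :=
        H.v_commute_xprod fun i hi => by have := hT' i hi; omega
      have e : v (n + 3) * (xprod x T * v (n + 2)) + xprod x T * v (n + 2) * v (n + 3)
          = xprod x (insert (n + 2) T) * v (n + 5) := by
        rw [← mul_assoc, hc.eq, mul_assoc, mul_assoc, ← mul_add, add_comm,
          H.v_anticomm_v_succ (n + 2), H.xprod_insert h2, (H.x_commute_xprod _ _).eq, mul_assoc]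
      refine .inr ⟨insert (n + 2) T, n + 5, le_rfl, ?_, ?_, e⟩
      · intro i hi
        obtain rfl | hi := Finset.mem_insert.1 hi
        · exact ⟨by omega, le_rfl⟩
        · exact ⟨hT1 i hi, by have := hT' i hi; omega⟩
      · unfold monWeight
        simp only [Nat.succ_eq_add_one, add_assoc, Nat.reduceAdd]
        rw [Finset.sum_insert h2, pivotWeight_add_five, pivotWeight_add_two, pivotWeight_succ]
        have := pivotWeight_pos n
        linarith
    · refine (ih (m - (n + 3)) (by omega) (n := n + 3) (by omega) (by omega) rfl).mono le_rfl ?_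
      rw [pivotWeight_add_three, pivotWeight_succ]
      have := pivotWeight_pos n
      linarith
  rw [hv]
  have h1 := H.isZeroOrMonomial_x_mul key (i := n + 1) (by omega) (by omega)
  have h2 := H.isZeroOrMonomial_x_mul h1 (i := n) (by omega) (by omega)
  exact h2.mono (by omega) (by linarith)

/-- For `n ≤ m` the letters of `S` lie below both pivots, so `x^S` factors out of the bracket with
`v_n`. That bracket has a pivot of index at least `n + 2`, so even the exceptional letter `n - 2`
becomes an ordinary one. -/
theorem isZeroOrMonomial_anticomm (H : IsPivotSystem x d v) {k n m : ℕ} {S T : Finset ℕ}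
    (hn : k ≤ n) (hm : k ≤ m) (hS : Admissible k S n) (hT : Admissible k T m) :
    IsZeroOrMonomial x v k (k + 2) (monWeight S n + monWeight T m)
      (xprod x S * v n * (xprod x T * v m) + xprod x T * v m * (xprod x S * v n)) := by
  wlog hnm : n ≤ m generalizing n m S T
  · rw [add_comm (_ * _), add_comm (monWeight S n)]
    exact this hm hn hT hS (by omega)
  have hc : Commute (xprod x S) (xprod x T * v m) :=
    (H.commute_xprod fun i _ => (H.x_commute_xprod i S).symm).mul_right
      (H.v_commute_xprod fun i hi => by have := hS.add_two_le hi; omega).symm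
  have e : xprod x S * v n * (xprod x T * v m) + xprod x T * v m * (xprod x S * v n)
      = xprod x S * (v n * (xprod x T * v m) + xprod x T * v m * v n) := by
    rw [mul_add, mul_assoc, ← mul_assoc _ (xprod x S), ← hc.eq, mul_assoc (xprod x S) _ (v n)]
  rw [e]
  refine (H.isZeroOrMonomial_xprod_mul (H.isZeroOrMonomial_v_anticomm hn hnm hT) S ?_).mono
    (by omega) ?_
  · intro i hi
    exact ⟨hS.1 i hi, by have := hS.add_two_le hi; omega⟩
  · unfold monWeight; linarith

end Bracket

end IsPivotSystem

end FractalLie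

/-! ### Weight-bounded spans of admissible monomials -/

namespace FractalLie

/-- The span of the admissible monomials `x^S v_n` with letters in `[k, ∞)`, `n ≥ q`, and of
weight at most `W`. -/
def monSpan (K : Type*) {A : Type*} [Field K] [Ring A] [Algebra K A] (x v : ℕ → A) (k q : ℕ)
    (W : ℚ) : Submodule K A :=
  Submodule.span K {a | ∃ (S : Finset ℕ) (n : ℕ), q ≤ n ∧ Admissible k S n ∧ monWeight S n ≤ W ∧
    a = xprod x S * v n}

section MonSpan

variable {K A : Type*} [Field K] [Ring A] [Algebra K A] {x d v : ℕ → A}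

theorem monSpan_mono {k q q' : ℕ} {W W' : ℚ} (hq : q' ≤ q) (hW : W ≤ W') :
    monSpan K x v k q W ≤ monSpan K x v k q' W' := by
  refine Submodule.span_mono ?_
  rintro a ⟨S, n, h1, h2, h3, rfl⟩
  exact ⟨S, n, hq.trans h1, h2, h3.trans hW, rfl⟩

theorem IsZeroOrMonomial.mem_monSpan {k q : ℕ} {W : ℚ} {a : A}
    (h : IsZeroOrMonomial x v k q W a) : a ∈ monSpan K x v k q W := by
  obtain rfl | ⟨U, p, h1, h2, h3, rfl⟩ := h
  · exact zero_mem _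
  · exact Submodule.subset_span
      ⟨U, p, h1, ⟨fun i hi => (h2 i hi).1, .inl fun i hi => (h2 i hi).2⟩, h3, rfl⟩

theorem monSpan_eq_bot {k : ℕ} {W : ℚ} (h : W < pivotWeight k) : monSpan K x v k k W = ⊥ := by
  rw [monSpan, Submodule.span_eq_bot]
  rintro a ⟨S, n, h1, h2, h3, rfl⟩
  exact absurd (h3.trans_lt h) (pivotWeight_le_monWeight h1 h2).not_gt

namespace IsPivotSystem

theorem commute_x_of_mem_monSpan (H : IsPivotSystem x d v) {j k q : ℕ} {W : ℚ} (hj : j < q)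
    {a : A} (ha : a ∈ monSpan K x v k q W) : Commute (x j) a := by
  induction ha using Submodule.span_induction with
  | mem a ha =>
    obtain ⟨S, n, h1, h2, h3, rfl⟩ := ha
    exact (H.x_commute_xprod j S).mul_right (H.x_v _ _ (by omega))
  | zero => exact Commute.zero_right _
  | add a b _ _ ha hb => exact ha.add_right hb
  | smul c a _ ha => exact ha.smul_right c

theorem commute_d_of_mem_monSpan (H : IsPivotSystem x d v) {j k q : ℕ} {W : ℚ} (hj : j < q)
    (hk : j < k) {a : A} (ha : a ∈ monSpan K x v k q W) : Commute (d j) a := by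
  induction ha using Submodule.span_induction with
  | mem a ha =>
    obtain ⟨S, n, h1, h2, h3, rfl⟩ := ha
    exact (H.commute_xprod fun i hi => H.d_x_comm j i (by have := h2.1 i hi; omega)).mul_right
      (H.d_v _ _ (by omega))
  | zero => exact Commute.zero_right _
  | add a b _ _ ha hb => exact ha.add_right hb
  | smul c a _ ha => exact ha.smul_right c

/-- Expansion of an element of the span with respect to `x_k` and `∂_k`. -/
theorem exists_expansion (H : IsPivotSystem x d v) {k q : ℕ} {W : ℚ} (hq : k ≤ q) {a : A}
    (ha : a ∈ monSpan K x v k q W) :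
    ∃ (t : K) (b c : A), a = t • d k + b + x k * c ∧ b ∈ monSpan K x v (k + 1) (k + 1) W ∧
      c ∈ monSpan K x v (k + 1) (k + 2) (W + pivotWeight k) ∧
      (t ≠ 0 → q = k ∧ pivotWeight k ≤ W) := by
  induction ha using Submodule.span_induction with
  | mem a ha =>
    obtain ⟨S, n, h1, h2, h3, rfl⟩ := ha
    by_cases hk : k ∈ S
    · have hn := h2.add_two_le hk
      refine ⟨0, 0, xprod x (S.erase k) * v n, ?_, zero_mem _, ?_, fun h => absurd rfl h⟩
      · rw [← mul_assoc, ← H.xprod_insert (Finset.notMem_erase k S), Finset.insert_erase hk]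
        simp
      · refine Submodule.subset_span ⟨_, n, hn, ⟨?_, .inl ?_⟩, ?_, rfl⟩
        · intro i hi
          have := h2.1 i (Finset.mem_of_mem_erase hi)
          have := Finset.ne_of_mem_erase hi
          omega
        · intro i hi
          obtain ⟨-, h2 | ⟨j, rfl, rfl⟩⟩ := h2
          · exact h2 i (Finset.mem_of_mem_erase hi)
          · simp at hi hk; omega
        · have := Finset.add_sum_erase S pivotWeight hk
          unfold monWeight at h3 ⊢
          linarith
    · rcases eq_or_lt_of_le (hq.trans h1) with rfl | hkn
      · have hS : S = ∅ := by
          ext i; simp only [Finset.notMem_empty, iff_false]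
          intro hi; have := h2.add_two_le hi; have := h2.1 i hi; omega
        subst hS
        have hW : pivotWeight k ≤ W := by simpa [monWeight] using h3
        -- The only source of `d_k` is `v_k` itself. Its tail `x_{k+1} v_{k+3}` is of the
        -- exceptional admissible form, of weight 15/8 ≤ 2 times that of `v_k`.
        refine ⟨1, 0, x (k + 1) * v (k + 3), ?_, zero_mem _, ?_, fun _ => ⟨by omega, hW⟩⟩
        · rw [xprod_empty, one_mul, one_smul, add_zero]
          exact H.v_eq k
        · refine Submodule.subset_span ⟨{k + 1}, k + 3, by omega, ⟨by simp, .inr ⟨k + 1, rfl, rfl⟩⟩,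
            ?_, by rw [xprod_singleton]⟩
          rw [monWeight, Finset.sum_singleton, pivotWeight_add_three, pivotWeight_succ]
          have := pivotWeight_pos k
          linarith
      · refine ⟨0, xprod x S * v n, 0, by simp, ?_, zero_mem _, fun h => absurd rfl h⟩
        refine Submodule.subset_span ⟨S, n, hkn, ⟨?_, h2.2⟩, h3, rfl⟩
        intro i hi
        have := h2.1 i hi
        have : i ≠ k := fun h => hk (h ▸ hi)
        omega
  | zero => exact ⟨0, 0, 0, by simp, zero_mem _, zero_mem _, fun h => absurd rfl h⟩
  | add a a' _ _ ha ha' =>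
    obtain ⟨t, b, c, rfl, hb, hc, ht⟩ := ha
    obtain ⟨t', b', c', rfl, hb', hc', ht'⟩ := ha'
    refine ⟨t + t', b + b', c + c', ?_, add_mem hb hb', add_mem hc hc', ?_⟩
    · rw [add_smul, mul_add]; abel
    · intro h
      by_cases h0 : t = 0
      · exact ht' fun h' => h (by rw [h0, h', add_zero])
      · exact ht h0
  | smul s a _ ha =>
    obtain ⟨t, b, c, rfl, hb, hc, ht⟩ := ha
    refine ⟨s * t, s • b, s • c, ?_, Submodule.smul_mem _ _ hb, Submodule.smul_mem _ _ hc,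
      fun h => ht (right_ne_zero_of_mul h)⟩
    rw [smul_add, smul_add, mul_smul, mul_smul_comm]

variable [CharP A 2]

theorem anticomm_mem_monSpan (H : IsPivotSystem x d v) {k : ℕ} {W W' : ℚ} {a b : A}
    (ha : a ∈ monSpan K x v k k W) (hb : b ∈ monSpan K x v k k W') :
    a * b + b * a ∈ monSpan K x v k (k + 2) (W + W') := by
  induction ha, hb using Submodule.span_induction₂ with
  | mem_mem a b ha hb =>
    obtain ⟨S, n, h1, h2, h3, rfl⟩ := ha
    obtain ⟨T, m, h1', h2', h3', rfl⟩ := hb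
    exact ((H.isZeroOrMonomial_anticomm h1 h1' h2 h2').mono le_rfl
      (add_le_add h3 h3')).mem_monSpan
  | zero_left b _ => simp
  | zero_right a _ => simp
  | add_left a a' b _ _ _ h h' =>
    convert add_mem h h' using 1; noncomm_ring
  | add_right a b b' _ _ _ h h' =>
    convert add_mem h h' using 1; noncomm_ring
  | smul_left c a b _ _ h =>
    rw [smul_mul_assoc, mul_smul_comm, ← smul_add]; exact Submodule.smul_mem _ c h
  | smul_right c a b _ _ h =>
    rw [smul_mul_assoc, mul_smul_comm, ← smul_add]; exact Submodule.smul_mem _ c h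

/-- Squares of sums polarize into squares and brackets; a monomial with at least one letter squares
to zero, so only the pivots contribute. -/
theorem mul_self_mem_monSpan (H : IsPivotSystem x d v) {k : ℕ} {W : ℚ} {a : A}
    (ha : a ∈ monSpan K x v k k W) : a * a ∈ monSpan K x v k (k + 2) (2 * W) := by
  induction ha using Submodule.span_induction with
  | mem a ha =>
    obtain ⟨S, n, h1, h2, h3, rfl⟩ := ha
    rcases S.eq_empty_or_nonempty with rfl | hS
    · rw [xprod_empty, one_mul, H.v_mul_self, ← xprod_singleton x (n + 1)]
      refine Submodule.subset_span ⟨{n + 1}, n + 3, by omega,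
        ⟨by simpa using (by omega : k ≤ n + 1), .inr ⟨n + 1, rfl, rfl⟩⟩, ?_, rfl⟩
      rw [monWeight, Finset.sum_empty] at h3
      rw [monWeight, Finset.sum_singleton, pivotWeight_add_three, pivotWeight_succ]
      have := pivotWeight_pos n
      linarith
    · have hc : Commute (v n) (xprod x S) :=
        H.v_commute_xprod fun i hi => by have := h2.add_two_le hi; omega
      rw [mul_assoc, ← mul_assoc (v n), hc.eq, mul_assoc, ← mul_assoc, H.xprod_mul_self hS,
        zero_mul]
      exact zero_mem _
  | zero => simp
  | add a b h h' ha hb =>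
    have hab := H.anticomm_mem_monSpan h h'
    rw [← two_mul] at hab
    have e : (a + b) * (a + b) = a * a + b * b + (a * b + b * a) := by noncomm_ring
    rw [e]
    exact add_mem (add_mem ha hb) hab
  | smul c a _ ha =>
    rw [smul_mul_assoc, mul_smul_comm]
    exact Submodule.smul_mem _ _ (Submodule.smul_mem _ _ ha)

/-! ### Nilpotency -/

-- Powers agree with those of `e` up to a multiple `y g` with `g` commuting with `y`; once `e ^ N =
-- 0`, the square of `y g` vanishes. No commutation of `e` with `f` is needed.
omit [CharP A 2] in
theorem _root_.FractalLie.isNilpotent_add_mul {y e f : A} (hy : y * y = 0) (he : Commute y e)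
    (hf : Commute y f) (h : IsNilpotent e) : IsNilpotent (e + y * f) := by
  have key : ∀ N : ℕ, ∃ g, Commute y g ∧ (e + y * f) ^ N = e ^ N + y * g := by
    intro N
    induction N with
    | zero => exact ⟨0, Commute.zero_right _, by simp⟩
    | succ N ih =>
      obtain ⟨g, hg, hN⟩ := ih
      refine ⟨e ^ N * f + g * e, ((he.pow_right N).mul_right hf).add_right (hg.mul_right he), ?_⟩
      have e1 : y * g * (y * f) = 0 := by
        rw [hg.eq, mul_assoc, ← mul_assoc y, hy, zero_mul, mul_zero]
      rw [pow_succ, hN, mul_add, add_mul, add_mul, e1, add_zero, ← mul_assoc (e ^ N),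
        ← (he.pow_right N).eq, pow_succ, mul_add]
      simp only [mul_assoc]
      abel
  obtain ⟨N, hN⟩ := h
  obtain ⟨g, hg, h⟩ := key N
  refine ⟨N + N, ?_⟩
  rw [pow_add, h, hN, zero_add, mul_assoc, ← mul_assoc g, ← hg.eq]
  simp only [← mul_assoc, hy, zero_mul]

/-- Every element of the span of the admissible monomials is nilpotent: expanding twice with
respect to the lowest letter contracts the normalized weight. -/
theorem isNilpotent_of_mem_monSpan_of_lt (H : IsPivotSystem x d v) (N : ℕ) :
    ∀ (k : ℕ) (W : ℚ) (a : A), W < pivotWeight k * (9 / 8) ^ N → a ∈ monSpan K x v k k W →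
      IsNilpotent a := by
  induction N with
  | zero =>
    intro k W a hW ha
    rw [monSpan_eq_bot (by simpa using hW), Submodule.mem_bot] at ha
    exact ha ▸ IsNilpotent.zero
  | succ N ih =>
    intro k W a hW ha
    have hpos : 0 < pivotWeight k * (9 / 8) ^ N := mul_pos (pivotWeight_pos k) (by positivity)
    rw [pow_succ] at hW
    obtain ⟨t, b, c, rfl, hb, hc, ht⟩ := H.exists_expansion le_rfl ha
    have hxb := H.commute_x_of_mem_monSpan (j := k) (by omega) hb
    have hxc := H.commute_x_of_mem_monSpan (j := k) (by omega) hc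
    have hdb := H.commute_d_of_mem_monSpan (j := k) (by omega) (by omega) hb
    -- Without `d_k` one passes to level `k + 1` with the same `W`; the gain 3/2 exceeds the
    -- required 9/8.
    by_cases h0 : t = 0
    · rw [h0, zero_smul, zero_add]
      refine isNilpotent_add_mul (H.x_sq k) hxb hxc (ih (k + 1) W b ?_ hb)
      rw [pivotWeight_succ]
      linarith
    have hW' := (ht h0).2
    set e := t • c + b * b with he
    have hxe : Commute (x k) e := (hxc.smul_right t).add_right (hxb.mul_right hxb)
    have hsq : (t • d k + b + x k * c) * (t • d k + b + x k * c)
        = e + x k * (b * c + c * b) := by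
      have e1 : d k * b = b * d k := hdb.eq
      have e2 : x k * c * (x k * c) = 0 := by
        rw [mul_assoc (x k), ← mul_assoc c, ← hxc.eq]
        simp only [← mul_assoc, H.x_sq, zero_mul]
      have e3 : d k * (x k * c) + x k * c * d k = c := by
        have hdc := H.commute_d_of_mem_monSpan (j := k) (by omega) (by omega) hc
        rw [mul_assoc, ← hdc.eq, ← mul_assoc, ← mul_assoc, ← add_mul, H.d_x, one_mul]
      have e4 : b * d k + b * d k = 0 := CharTwo.add_self_eq_zero _
      have e5 : b * (x k * c) = x k * (b * c) := by rw [← mul_assoc, ← hxb.eq, mul_assoc]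
      calc (t • d k + b + x k * c) * (t • d k + b + x k * c)
          = (t * t) • (d k * d k) + b * b + x k * c * (x k * c) + t • (d k * b + b * d k)
            + t • (d k * (x k * c) + x k * c * d k) + (b * (x k * c) + x k * c * b) := by
            simp only [add_mul, mul_add, smul_mul_assoc, mul_smul_comm, smul_smul, smul_add]
            abel
        _ = _ := by
            rw [H.d_sq, e2, e1, e4, e3, e5, he, mul_add, smul_zero, smul_zero, mul_assoc]
            abel
    -- The weight `W + pivotWeight k` of `c` is at most `2 * W` because `t ≠ 0` forces `pivotWeight
    -- k ≤ W`.
    have hemem : e ∈ monSpan K x v (k + 1) (k + 2) (2 * W) :=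
      add_mem (Submodule.smul_mem _ _ (monSpan_mono le_rfl (by linarith) hc))
        (monSpan_mono (by omega) le_rfl (H.mul_self_mem_monSpan hb))
    have hnil : IsNilpotent e := by
      obtain ⟨s, b', c', hs, hb', hc', hs'⟩ := H.exists_expansion (by omega) hemem
      -- All pivots in `e` have index at least `k + 2`, so `d_{k+1}` does not occur.
      have hs0 : s = 0 := by
        by_contra h
        have := (hs' h).1
        omega
      rw [hs, hs0, zero_smul, zero_add]
      refine isNilpotent_add_mul (H.x_sq _) (H.commute_x_of_mem_monSpan (by omega) hb')
        (H.commute_x_of_mem_monSpan (by omega) hc') (ih (k + 2) (2 * W) b' ?_ hb')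
      -- The weight has doubled and the unit has grown by 9/4 = 2 · 9/8, which uses up exactly one
      -- factor 9/8.
      rw [pivotWeight_add_two]
      linarith
    obtain ⟨M, hM⟩ := isNilpotent_add_mul (H.x_sq k) hxe
      ((hxb.mul_right hxc).add_right (hxc.mul_right hxb)) hnil
    refine ⟨2 * M, ?_⟩
    rw [pow_mul, sq, hsq, hM]

theorem isNilpotent_of_mem_monSpan (H : IsPivotSystem x d v) {k : ℕ} {W : ℚ} {a : A}
    (ha : a ∈ monSpan K x v k k W) : IsNilpotent a := by
  obtain ⟨N, hN⟩ := pow_unbounded_of_one_lt (W / pivotWeight k) (by norm_num : (1 : ℚ) < 9 / 8)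
  rw [div_lt_iff₀' (pivotWeight_pos k)] at hN
  exact H.isNilpotent_of_mem_monSpan_of_lt N k W a hN ha

end IsPivotSystem

end MonSpan

end FractalLie

namespace FractalLie

/-! ### The subalgebra spanned by the admissible monomials of a subspace -/

section Generation

variable {K A : Type*} [Field K] [Ring A] [Algebra K A] [CharP A 2] {x d v : ℕ → A}

/-- The admissible monomials `x^S v_n`. -/
def admissibleMonomials (x v : ℕ → A) : Set A :=
  {a | ∃ (S : Finset ℕ) (n : ℕ), Admissible 0 S n ∧ a = xprod x S * v n}

omit [CharP A 2] in
theorem v_mem_admissibleMonomials (x v : ℕ → A) (n : ℕ) : v n ∈ admissibleMonomials x v :=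
  ⟨∅, n, Admissible.empty 0 n, by rw [IsPivotSystem.xprod_empty, one_mul]⟩

theorem IsPivotSystem.anticomm_eq_zero_or_mem (H : IsPivotSystem x d v) {a b : A}
    (ha : a ∈ admissibleMonomials x v) (hb : b ∈ admissibleMonomials x v) :
    a * b + b * a = 0 ∨ a * b + b * a ∈ admissibleMonomials x v := by
  obtain ⟨S, n, hS, rfl⟩ := ha
  obtain ⟨T, m, hT, rfl⟩ := hb
  obtain h | ⟨U, p, -, hU, -, h⟩ :=
    H.isZeroOrMonomial_anticomm (Nat.zero_le n) (Nat.zero_le m) hS hT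
  · exact .inl h
  · exact .inr ⟨U, p, ⟨fun i _ => Nat.zero_le i, .inl fun i hi => (hU i hi).2⟩, h⟩

omit [CharP A 2] in
theorem exists_mem_monSpan_of_mem_span {s : Set A} (hs : s ⊆ admissibleMonomials x v) {a : A}
    (ha : a ∈ Submodule.span K s) : ∃ W, a ∈ monSpan K x v 0 0 W := by
  induction ha using Submodule.span_induction with
  | mem a ha =>
    obtain ⟨S, n, hS, rfl⟩ := hs ha
    exact ⟨_, Submodule.subset_span ⟨S, n, Nat.zero_le n, hS, le_rfl, rfl⟩⟩
  | zero => exact ⟨0, zero_mem _⟩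
  | add a b _ _ ha hb =>
    obtain ⟨W, ha⟩ := ha
    obtain ⟨W', hb⟩ := hb
    exact ⟨max W W', add_mem (monSpan_mono le_rfl (le_max_left _ _) ha)
      (monSpan_mono le_rfl (le_max_right _ _) hb)⟩
  | smul c a _ ha =>
    obtain ⟨W, ha⟩ := ha
    exact ⟨W, Submodule.smul_mem _ c ha⟩

/-- If a subspace `S` contains the brackets of its admissible monomials and the squares of its
pivot elements, then the admissible monomials of `S` span a restricted Lie algebra. -/
theorem IsPivotSystem.restrictedLieClosure_le_span (H : IsPivotSystem x d v) {X : Set A}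
    (S : Submodule K A) (hX : X ⊆ admissibleMonomials x v) (hXS : X ⊆ S)
    (hbr : ∀ a ∈ admissibleMonomials x v, ∀ b ∈ admissibleMonomials x v, a ∈ S → b ∈ S →
      a * b + b * a ∈ S)
    (hsq : ∀ n, v n ∈ S → v n * v n ∈ S) :
    (restrictedLieClosure K 2 X).toSubmodule
      ≤ Submodule.span K (admissibleMonomials x v ∩ S) := by
  set M := Submodule.span K (admissibleMonomials x v ∩ S) with hM
  -- Decisive here: the bracket of two monomials is a single monomial, so lying in `S` puts it in
  -- the spanning set.
  have hanti : ∀ a ∈ M, ∀ b ∈ M, a * b + b * a ∈ M := by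
    intro a ha b hb
    induction ha, hb using Submodule.span_induction₂ with
    | mem_mem a b ha hb =>
      obtain h | h := H.anticomm_eq_zero_or_mem ha.1 hb.1
      · rw [h]; exact zero_mem _
      · exact Submodule.subset_span ⟨h, hbr a ha.1 b hb.1 ha.2 hb.2⟩
    | zero_left b _ => simp
    | zero_right a _ => simp
    | add_left a a' b _ _ _ h h' =>
      have e : (a + a') * b + b * (a + a') = (a * b + b * a) + (a' * b + b * a') := by
        noncomm_ring
      exact e ▸ add_mem h h'
    | add_right a b b' _ _ _ h h' =>
      have e : a * (b + b') + (b + b') * a = (a * b + b * a) + (a * b' + b' * a) := by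
        noncomm_ring
      exact e ▸ add_mem h h'
    | smul_left c a b _ _ h =>
      rw [smul_mul_assoc, mul_smul_comm, ← smul_add]; exact Submodule.smul_mem _ c h
    | smul_right c a b _ _ h =>
      rw [smul_mul_assoc, mul_smul_comm, ← smul_add]; exact Submodule.smul_mem _ c h
  have hsquare : ∀ a ∈ M, a ^ 2 ∈ M := by
    intro a ha
    rw [sq]
    induction ha using Submodule.span_induction with
    | mem a ha =>
      obtain ⟨⟨T, n, hT, rfl⟩, haS⟩ := ha
      rcases T.eq_empty_or_nonempty with rfl | hne
      · rw [xprod_empty, one_mul] at haS ⊢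
        refine Submodule.subset_span ⟨⟨{n + 1}, n + 3, ⟨by simp, .inr ⟨n + 1, rfl, rfl⟩⟩, ?_⟩,
          hsq n haS⟩
        rw [H.v_mul_self, xprod_singleton]
      · have hc : Commute (v n) (xprod x T) :=
          H.v_commute_xprod fun i hi => by have := hT.add_two_le hi; omega
        rw [mul_assoc, ← mul_assoc (v n), hc.eq, mul_assoc, ← mul_assoc, H.xprod_mul_self hne,
          zero_mul]
        exact zero_mem _
    | zero => simp
    | add a b h h' ha hb =>
      have e : (a + b) * (a + b) = a * a + b * b + (a * b + b * a) := by noncomm_ring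
      rw [e]
      exact add_mem (add_mem ha hb) (hanti a h b h')
    | smul c a _ ha =>
      rw [smul_mul_assoc, mul_smul_comm]
      exact Submodule.smul_mem _ _ (Submodule.smul_mem _ _ ha)
  let L : LieSubalgebra K A :=
    { M with
      lie_mem' := fun {a b} ha hb => by
        rw [LieRing.of_associative_ring_bracket, CharTwo.sub_eq_add]
        exact hanti a ha b hb }
  have hL : restrictedLieClosure K 2 X ≤ L :=
    sInf_le ⟨fun a ha => Submodule.subset_span ⟨hX ha, hXS ha⟩, hsquare⟩
  exact hL

end Generation

/-! ### Restricted closures and the squaring map -/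

section Closure

variable {K A : Type*} [Field K] [Ring A] [Algebra K A]

theorem subset_restrictedLieClosure (p : ℕ) (X : Set A) :
    X ⊆ (restrictedLieClosure K p X : Set A) := by
  rw [restrictedLieClosure, LieSubalgebra.coe_sInf]
  exact Set.subset_iInter₂ fun S hS => hS.1

theorem mul_self_mem_restrictedLieClosure {X : Set A} {a : A}
    (ha : a ∈ restrictedLieClosure K 2 X) : a * a ∈ restrictedLieClosure K 2 X :=
  sq a ▸ pow_mem_restrictedLieClosure K 2 X ha

theorem anticomm_mem_restrictedLieClosure [CharP A 2] {p : ℕ} {X : Set A} {a b : A}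
    (ha : a ∈ restrictedLieClosure K p X) (hb : b ∈ restrictedLieClosure K p X) :
    a * b + b * a ∈ restrictedLieClosure K p X := by
  have := (restrictedLieClosure K p X).lie_mem ha hb
  rwa [LieRing.of_associative_ring_bracket, CharTwo.sub_eq_add] at this

/-- In characteristic `2`, squaring is a `2`-mapping on every restricted Lie subalgebra. -/
theorem isPMapping_restrictedLieClosurePMap_two [CharP K 2] [CharP A 2] (X : Set A) :
    IsPMapping K (restrictedLieClosure K 2 X) 2 (restrictedLieClosurePMap K 2 X) where
  map_smul c a := by
    ext
    simp [restrictedLieClosurePMap, smul_pow]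
  ad_map a := by
    ext b
    simp only [sq, Module.End.mul_apply, LieAlgebra.ad_apply, restrictedLieClosurePMap,
      LieSubalgebra.coe_bracket, LieRing.of_associative_ring_bracket, CharTwo.sub_eq_add]
    have := CharTwo.add_self_eq_zero ((a : A) * (b : A) * a)
    simp only [mul_add, add_mul, mul_assoc] at this ⊢
    rw [add_assoc, ← add_assoc ((a : A) * (b * a)), this, zero_add]
  map_add a b := by
    ext
    -- For `p = 2` only `i = 1` occurs, and the `t`-term of `⁅t a + b, a⁆` vanishes.
    have e : jacobsonS K (restrictedLieClosure K 2 X) 2 1 a b = ⁅b, a⁆ := by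
      have h : ⁅(Polynomial.X : Polynomial K) ⊗ₜ[K] a + (1 : Polynomial K) ⊗ₜ[K] b,
          (1 : Polynomial K) ⊗ₜ[K] a⁆ = (1 : Polynomial K) ⊗ₜ[K] ⁅b, a⁆ := by
        refine (add_lie (L := Polynomial K ⊗[K] restrictedLieClosure K 2 X)
          (M := Polynomial K ⊗[K] restrictedLieClosure K 2 X) _ _ _).trans ?_
        rw [LieAlgebra.ExtendScalars.bracket_tmul, LieAlgebra.ExtendScalars.bracket_tmul,
          lie_self, TensorProduct.tmul_zero, zero_add, mul_one]
      simp [jacobsonS, lieCoeff, h]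
    have h : Finset.Ico 1 2 = {1} := rfl
    rw [h, Finset.sum_singleton, e]
    change ((a : A) + b) ^ 2 = (a : A) ^ 2 + (b : A) ^ 2 + ⁅(b : A), (a : A)⁆
    rw [LieRing.of_associative_ring_bracket, CharTwo.sub_eq_add]
    noncomm_ring

theorem isNilPMapping_of_isNilpotent {p : ℕ} (hp : 1 < p) {X : Set A}
    (h : ∀ a ∈ restrictedLieClosure K p X, IsNilpotent a) :
    IsNilPMapping (restrictedLieClosurePMap K p X) := by
  intro a
  obtain ⟨N, hN⟩ := h a a.2
  have key : ∀ n : ℕ, (((restrictedLieClosurePMap K p X)^[n] a : _) : A) = (a : A) ^ p ^ n := by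
    intro n
    induction n with
    | zero => simp
    | succ n ih =>
      rw [Function.iterate_succ_apply', pow_succ, pow_mul, ← ih]
      rfl
  refine ⟨N, Subtype.ext ?_⟩
  rw [key]
  exact pow_eq_zero_of_le (Nat.lt_pow_self hp).le hN

end Closure

end FractalLie

namespace FractalLie

/-! ### The pivot elements of the Grassmann algebra -/

variable {K : Type*} [Field K]

theorem gx_mul_self (i : ℕ) : gx K i * gx K i = 0 :=
  ExteriorAlgebra.ι_sq_zero _

theorem gd_gx_mul (i j : ℕ) (f : Grassmann K) :
    gd K i (gx K j * f) = (if i = j then f else 0) - gx K j * gd K i f := by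
  refine (CliffordAlgebra.contractLeft_ι_mul _ _ _).trans ?_
  congr 1
  by_cases h : i = j
  · subst h; simp
  · simp [h]

theorem gd_gd (i : ℕ) (f : Grassmann K) : gd K i (gd K i f) = 0 :=
  CliffordAlgebra.contractLeft_contractLeft _ _

theorem gd_gd_comm (i j : ℕ) (f : Grassmann K) : gd K i (gd K j f) = -gd K j (gd K i f) :=
  CliffordAlgebra.contractLeft_comm _ _ _

theorem pivot_apply (i : ℕ) (f : Grassmann K) :
    pivot K i f = ∑ᶠ l : ℕ, pivotCoeff K i l * gd K (i + 3 * l) f := rfl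

/-- Peels off the outermost pair of letters, whereas the definition appends the innermost one; this
is the form the recursion for the pivots requires. -/
theorem pivotCoeff_succ' (i l : ℕ) :
    pivotCoeff K i (l + 1) = gx K i * gx K (i + 1) * pivotCoeff K (i + 3) l := by
  induction l with
  | zero => simp [pivotCoeff]
  | succ l ih =>
    rw [pivotCoeff, ih, pivotCoeff, mul_assoc _ (pivotCoeff K (i + 3) l)]
    have : i + 3 * (l + 1) = i + 3 + 3 * l := by ring
    rw [this]

theorem pivot_eq (i : ℕ) (f : Grassmann K) :
    pivot K i f = gd K i f + gx K i * (gx K (i + 1) * pivot K (i + 3) f) := by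
  -- A common truncation bound turns both sums into finite ones; the first gets one more term, since
  -- its term `l = 0` is split off as `d_i`.
  obtain ⟨N, hN⟩ := ((finite_pivot_support K i f).union (finite_pivot_support K (i + 3) f)).bddAbove
  have h1 : pivot K i f = ∑ l ∈ Finset.range (N + 2), pivotCoeff K i l * gd K (i + 3 * l) f :=
    finsum_eq_sum_of_support_subset _ fun l hl => by
      have := hN (Or.inl hl); simp; omega
  have h2 : pivot K (i + 3) f
      = ∑ l ∈ Finset.range (N + 1), pivotCoeff K (i + 3) l * gd K (i + 3 + 3 * l) f :=
    finsum_eq_sum_of_support_subset _ fun l hl => by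
      have := hN (Or.inr hl); simp; omega
  rw [h1, h2, Finset.sum_range_succ', Finset.mul_sum, Finset.mul_sum, add_comm]
  congr 1
  · simp [pivotCoeff]
  · refine Finset.sum_congr rfl fun l _ => ?_
    rw [pivotCoeff_succ']
    have : i + 3 * (l + 1) = i + 3 + 3 * l := by ring
    rw [this]
    simp only [mul_assoc]

section CharTwo

variable [CharP K 2]

instance charP_grassmann : CharP (Grassmann K) 2 :=
  charP_of_injective_algebraMap (algebraMap K (Grassmann K)).injective 2

instance charP_end_grassmann : CharP (Module.End K (Grassmann K)) 2 :=
  charP_of_injective_algebraMap (algebraMap K (Module.End K (Grassmann K))).injective 2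

theorem gx_comm (i j : ℕ) : gx K i * gx K j = gx K j * gx K i := by
  have := ExteriorAlgebra.ι_add_mul_swap (R := K) (Finsupp.single i (1 : K))
    (Finsupp.single j (1 : K))
  rw [← CharTwo.sub_eq_add] at this
  exact sub_eq_zero.1 this

theorem pivotCoeff_comm (i l j : ℕ) :
    pivotCoeff K i l * gx K j = gx K j * pivotCoeff K i l := by
  induction l with
  | zero => simp [pivotCoeff]
  | succ l ih =>
    rw [pivotCoeff, mul_assoc, mul_assoc, gx_comm _ j, ← mul_assoc (gx K _) (gx K j), gx_comm _ j,
      mul_assoc (gx K j), ← mul_assoc, ih, mul_assoc]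

omit [CharP K 2] in
theorem gd_pivotCoeff_mul (i l j : ℕ) (hj : j < i) (f : Grassmann K) :
    gd K j (pivotCoeff K i l * f) = pivotCoeff K i l * gd K j f := by
  induction l generalizing f with
  | zero => simp [pivotCoeff]
  | succ l ih =>
    rw [pivotCoeff, mul_assoc, ih, mul_assoc, gd_gx_mul, gd_gx_mul, if_neg (by omega),
      if_neg (by omega)]
    simp [mul_assoc]

variable (K) in
/-- In characteristic `2` the letters, the superderivatives and the pivot elements form a pivot
system in `End Λ`. -/
theorem isPivotSystem :
    IsPivotSystem (fun i => LinearMap.mulLeft K (gx K i)) (gd K) (pivot K) where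
  x_comm i j := by
    refine LinearMap.ext fun f => ?_
    simp only [Module.End.mul_apply, LinearMap.mulLeft_apply, ← mul_assoc, gx_comm i j]
  x_sq i := by
    refine LinearMap.ext fun f => ?_
    simp [← mul_assoc, gx_mul_self]
  d_sq i := by
    refine LinearMap.ext fun f => ?_
    exact gd_gd i f
  d_x i := by
    refine LinearMap.ext fun f => ?_
    simp [gd_gx_mul]
  d_x_comm i j hij := by
    refine LinearMap.ext fun f => ?_
    simp [gd_gx_mul, hij, CharTwo.neg_eq]
  v_eq i := by
    refine LinearMap.ext fun f => ?_
    exact pivot_eq i f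
  x_v i j hj := by
    refine LinearMap.ext fun f => ?_
    simp only [Module.End.mul_apply, LinearMap.mulLeft_apply, pivot_apply]
    refine (map_finsum (LinearMap.mulLeft K (gx K j)) (finite_pivot_support K i f)).trans ?_
    refine finsum_congr fun l => ?_
    rw [LinearMap.mulLeft_apply, gd_gx_mul, if_neg (by omega), zero_sub, CharTwo.neg_eq,
      ← mul_assoc, ← mul_assoc,
      pivotCoeff_comm]
  d_v i j hj := by
    refine LinearMap.ext fun f => ?_
    simp only [Module.End.mul_apply, pivot_apply]
    rw [map_finsum _ (finite_pivot_support K i f)]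
    refine finsum_congr fun l => ?_
    rw [gd_pivotCoeff_mul _ _ _ hj, gd_gd_comm, CharTwo.neg_eq]

end CharTwo

/-! ### Parity -/

theorem gx_mem_gParity (i : ℕ) : gx K i ∈ gParity K 1 :=
  CliffordAlgebra.ι_mem_evenOdd_one _ _

theorem mul_mem_gParity {α β : ZMod 2} {f g : Grassmann K} (hf : f ∈ gParity K α)
    (hg : g ∈ gParity K β) : f * g ∈ gParity K (α + β) :=
  CliffordAlgebra.evenOdd_mul_le _ α β (Submodule.mul_mem_mul hf hg)

theorem gd_mem_gParity (i : ℕ) {α : ZMod 2} {f : Grassmann K} (hf : f ∈ gParity K α) :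
    gd K i f ∈ gParity K (1 + α) := by
  have ι_mem : ∀ m : ℕ →₀ K, CliffordAlgebra.ι (0 : QuadraticForm K (ℕ →₀ K)) m ∈ gParity K 1 :=
    fun m => CliffordAlgebra.ι_mem_evenOdd_one _ m
  have gd_ι_mul : ∀ (m : ℕ →₀ K) (b : Grassmann K),
      gd K i (CliffordAlgebra.ι (0 : QuadraticForm K (ℕ →₀ K)) m * b)
        = m i • b - CliffordAlgebra.ι (0 : QuadraticForm K (ℕ →₀ K)) m * gd K i b :=
    fun m b => CliffordAlgebra.contractLeft_ι_mul _ _ _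
  have h2 : (1 : ZMod 2) + 1 = 0 := rfl
  -- Induction within a fixed parity multiplies by two vectors at a time.
  have step : ∀ (β : ZMod 2) (m₁ m₂ : ℕ →₀ K) (b : Grassmann K), b ∈ gParity K β →
      gd K i b ∈ gParity K (1 + β) →
      gd K i (CliffordAlgebra.ι (0 : QuadraticForm K (ℕ →₀ K)) m₁
        * CliffordAlgebra.ι (0 : QuadraticForm K (ℕ →₀ K)) m₂ * b) ∈ gParity K (1 + β) := by
    intro β m₁ m₂ b hb hgb
    rw [mul_assoc, gd_ι_mul, gd_ι_mul]
    refine sub_mem (Submodule.smul_mem _ _ (mul_mem_gParity (ι_mem m₂) hb)) ?_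
    have h : (1 : ZMod 2) + (1 + β) = β := by rw [← add_assoc, h2, zero_add]
    refine mul_mem_gParity (ι_mem m₁) (sub_mem (Submodule.smul_mem _ _ hb) ?_)
    have := mul_mem_gParity (ι_mem m₂) hgb
    rwa [h] at this
  obtain rfl | rfl : α = 0 ∨ α = 1 := by clear hf step; revert α; decide
  · induction f, hf using CliffordAlgebra.even_induction with
    | algebraMap r =>
      have : gd K i (algebraMap K _ r) = 0 := CliffordAlgebra.contractLeft_algebraMap _ _ r
      rw [this]
      exact zero_mem _
    | add f g _ _ hf hg => rw [map_add]; exact add_mem hf hg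
    | ι_mul_ι_mul m₁ m₂ b hb h => exact step 0 m₁ m₂ b hb h
  · induction f, hf using CliffordAlgebra.odd_induction with
    | ι m =>
      have : gd K i (CliffordAlgebra.ι (0 : QuadraticForm K (ℕ →₀ K)) m)
        = algebraMap K _ (m i) := CliffordAlgebra.contractLeft_ι _ _ _
      rw [this]
      exact SetLike.algebraMap_mem_graded (CliffordAlgebra.evenOdd _) (m i)
    | add f g _ _ hf hg => rw [map_add]; exact add_mem hf hg
    | ι_mul_ι_mul m₁ m₂ b hb h => exact step 1 m₁ m₂ b hb h

theorem mulLeft_gx_mem_endParity (i : ℕ) : LinearMap.mulLeft K (gx K i) ∈ endParity K 1 :=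
  fun _ _ hf => mul_mem_gParity (gx_mem_gParity i) hf

theorem mul_mem_endParity {α β : ZMod 2} {φ ψ : Module.End K (Grassmann K)}
    (hφ : φ ∈ endParity K α) (hψ : ψ ∈ endParity K β) : φ * ψ ∈ endParity K (α + β) :=
  fun γ f hf => by
    rw [add_assoc]
    exact hφ _ _ (hψ γ f hf)

theorem pivotCoeff_mem_gParity (i l : ℕ) : pivotCoeff K i l ∈ gParity K 0 := by
  induction l with
  | zero => exact CliffordAlgebra.one_le_evenOdd_zero _ (Submodule.one_le.1 le_rfl)
  | succ l ih =>
    have := mul_mem_gParity ih (mul_mem_gParity (gx_mem_gParity (i + 3 * l))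
      (gx_mem_gParity (i + 3 * l + 1)))
    exact this

theorem pivot_mem_endParity (i : ℕ) : pivot K i ∈ endParity K 1 := by
  intro α f hf
  rw [pivot_apply]
  refine finsum_induction (· ∈ gParity K (1 + α)) (zero_mem _) (fun _ _ => add_mem) fun l => ?_
  have := mul_mem_gParity (pivotCoeff_mem_gParity i l) (gd_mem_gParity (i + 3 * l) hf)
  rwa [zero_add] at this

theorem exists_mem_endParity_of_mem_admissibleMonomials [CharP K 2]
    {a : Module.End K (Grassmann K)}
    (ha : a ∈ admissibleMonomials (fun i => LinearMap.mulLeft K (gx K i)) (pivot K)) :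
    ∃ α, a ∈ endParity K α := by
  obtain ⟨S, n, -, rfl⟩ := ha
  induction S using Finset.induction_on with
  | empty =>
    refine ⟨1, ?_⟩
    rw [IsPivotSystem.xprod_empty, one_mul]
    exact pivot_mem_endParity n
  | insert i S hi ih =>
    obtain ⟨α, h⟩ := ih
    refine ⟨1 + α, ?_⟩
    rw [(isPivotSystem K).xprod_insert hi, mul_assoc]
    exact mul_mem_endParity (mulLeft_gx_mem_endParity i) h

/-! ### The main theorem -/

/-- Only gradedness is at stake: monomials are parity-homogeneous, so a span of monomials splits
into its even and odd parts. -/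
theorem isLieSuperSubalgebra_restrictedLieClosure_of_le [CharP K 2]
    {X : Set (Module.End K (Grassmann K))}
    (h : (restrictedLieClosure K 2 X).toSubmodule ≤ Submodule.span K
      (admissibleMonomials (fun i => LinearMap.mulLeft K (gx K i)) (pivot K)
        ∩ (restrictedLieClosure K 2 X).toSubmodule)) :
    IsLieSuperSubalgebra K (restrictedLieClosure K 2 X).toSubmodule where
  graded a ha := by
    have ha' := h ha
    clear ha
    induction ha' using Submodule.span_induction with
    | mem a ha =>
      obtain ⟨α, hα⟩ := exists_mem_endParity_of_mem_admissibleMonomials ha.1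
      obtain rfl | rfl : α = 0 ∨ α = 1 := by clear hα; revert α; decide
      · exact ⟨a, ⟨ha.2, hα⟩, 0, zero_mem _, (add_zero a).symm⟩
      · exact ⟨0, zero_mem _, a, ⟨ha.2, hα⟩, (zero_add a).symm⟩
    | zero => exact ⟨0, zero_mem _, 0, zero_mem _, (add_zero 0).symm⟩
    | add a b _ _ ha hb =>
      obtain ⟨a₀, ha₀, a₁, ha₁, rfl⟩ := ha
      obtain ⟨b₀, hb₀, b₁, hb₁, rfl⟩ := hb
      exact ⟨a₀ + b₀, add_mem ha₀ hb₀, a₁ + b₁, add_mem ha₁ hb₁, add_add_add_comm _ _ _ _⟩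
    | smul c a _ ha =>
      obtain ⟨a₀, ha₀, a₁, ha₁, rfl⟩ := ha
      exact ⟨c • a₀, Submodule.smul_mem _ c ha₀, c • a₁, Submodule.smul_mem _ c ha₁, smul_add _ _ _⟩
  bracket_mem α β a ha b hb := by
    rw [CharTwo.neg_eq, one_pow, one_smul, CharTwo.sub_eq_add]
    exact anticomm_mem_restrictedLieClosure ha.1 hb.1
  sq_mem a ha := pow_mem_restrictedLieClosure K 2 X ha.1

theorem subset_lieSuperClosure (X : Set (Module.End K (Grassmann K))) :
    X ⊆ (lieSuperClosure K X : Set (Module.End K (Grassmann K))) := fun _ ha =>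
  Submodule.mem_sInf.2 fun _ hS => hS.1 ha

theorem anticomm_mem_lieSuperClosure [CharP K 2] {X : Set (Module.End K (Grassmann K))}
    {a b : Module.End K (Grassmann K)} {α β : ZMod 2} (hα : a ∈ endParity K α)
    (hβ : b ∈ endParity K β) (ha : a ∈ lieSuperClosure K X) (hb : b ∈ lieSuperClosure K X) :
    a * b + b * a ∈ lieSuperClosure K X := by
  refine Submodule.mem_sInf.2 fun S hS => ?_
  have := hS.2.bracket_mem α β a ⟨Submodule.mem_sInf.1 ha S hS, hα⟩ b
    ⟨Submodule.mem_sInf.1 hb S hS, hβ⟩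
  rwa [CharTwo.neg_eq, one_pow, one_smul, CharTwo.sub_eq_add] at this

theorem mul_self_mem_lieSuperClosure {X : Set (Module.End K (Grassmann K))}
    {a : Module.End K (Grassmann K)} (hodd : a ∈ endParity K 1) (ha : a ∈ lieSuperClosure K X) :
    a * a ∈ lieSuperClosure K X := by
  refine Submodule.mem_sInf.2 fun S hS => ?_
  rw [← sq]
  exact hS.2.sq_mem a ⟨Submodule.mem_sInf.1 ha S hS, hodd⟩

theorem generators_subset_admissibleMonomials (K : Type*) [Field K] :
    generators K
      ⊆ admissibleMonomials (fun i => LinearMap.mulLeft K (gx K i)) (pivot K) := by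
  rintro a (rfl | rfl | rfl) <;> exact v_mem_admissibleMonomials _ _ _

end FractalLie

theorem mainTheorem10 (K : Type*) [Field K] [CharP K 2] :
    FractalLie.Q K = (FractalLie.restrictedLieClosure K 2 (FractalLie.generators K)).toSubmodule ∧
    FractalLie.IsPMapping K (FractalLie.restrictedLieClosure K 2 (FractalLie.generators K)) 2
      (FractalLie.restrictedLieClosurePMap K 2 (FractalLie.generators K)) ∧
    FractalLie.IsNilPMapping
      (FractalLie.restrictedLieClosurePMap K 2 (FractalLie.generators K)) := by
  have hX := FractalLie.generators_subset_admissibleMonomials K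
  have H := FractalLie.isPivotSystem K
  -- Taking `Lie_p` itself as the subspace: it is spanned by its own admissible monomials.
  have hspan := H.restrictedLieClosure_le_span (K := K)
    (FractalLie.restrictedLieClosure K 2 (FractalLie.generators K)).toSubmodule hX
    (FractalLie.subset_restrictedLieClosure 2 _)
    (fun a _ b _ ha hb => FractalLie.anticomm_mem_restrictedLieClosure ha hb)
    (fun n hn => FractalLie.mul_self_mem_restrictedLieClosure hn)
  refine ⟨le_antisymm ?_ ?_, FractalLie.isPMapping_restrictedLieClosurePMap_two _,
    FractalLie.isNilPMapping_of_isNilpotent one_lt_two fun a ha => ?_⟩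
  · exact sInf_le ⟨FractalLie.subset_restrictedLieClosure 2 _,
      FractalLie.isLieSuperSubalgebra_restrictedLieClosure_of_le hspan⟩
  -- Taking `Q` as the subspace: its superbrackets are available only for homogeneous elements,
  -- which monomials are.
  · refine (H.restrictedLieClosure_le_span (FractalLie.Q K) hX
      (FractalLie.subset_lieSuperClosure _) ?_ ?_).trans
      (Submodule.span_le.2 Set.inter_subset_right)
    · intro a ha b hb haQ hbQ
      obtain ⟨α, hα⟩ := FractalLie.exists_mem_endParity_of_mem_admissibleMonomials ha
      obtain ⟨β, hβ⟩ := FractalLie.exists_mem_endParity_of_mem_admissibleMonomials hb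
      exact FractalLie.anticomm_mem_lieSuperClosure hα hβ haQ hbQ
    · intro n hn
      exact FractalLie.mul_self_mem_lieSuperClosure (FractalLie.pivot_mem_endParity n) hn
  · obtain ⟨W, hW⟩ := FractalLie.exists_mem_monSpan_of_mem_span Set.inter_subset_left (hspan ha)
    exact H.isNilpotent_of_mem_monSpan hW
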